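/- Let $f(x)\in\mathbb{Z}[x]$ be a polynomial of odd degree $d\ge 3$ that is squarefree (as an element of $\mathbb{Q}[x]$), and let $n\ge d$ be an integer. Put \[ d_g=\begin{cases}(n-1)/2,& n\text{ odd}\\ n/2,& n\text{ even}\end{cases},\qquad d_h=\begin{cases}(n-d)/2,& n\text{ odd}\\ (n-d-1)/2,& n\text{ even}\end{cases}. \] Let $\mathbf a=(a_0,\dots,a_{d_g})$ and $\mathbf b=(b_0,\dots,b_{d_h})$ be independent variables over $\mathbb{Q}$, let $g(x)=\sum_{i=0}^{d_g}a_ix^i$ and $h(x)=\sum_{j=0}^{d_h}b_jx^j$, and set \[ F_f(x)=g(x)^2-f(x)h(x)^2\in\mathbb{Q}(\mathbf a,\mathbf b)[x]. \] Then $F_f$ is irreducible in $\mathbb{Q}(\mathbf a,\mathbf b)[x]$, and its Galois group $\mathrm{Gal}(F_f/\mathbb{Q}(\mathbf a,\mathbf b))$, that is, the Galois group of a splitting field of $F_f$ over $\mathbb{Q}(\mathbf a,\mathbf b)$, is isomorphic to the symmetric group $S_n$. -/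

import Mathlib

open Polynomial

noncomputable section

namespace HyperellipticFamily

/-- The degree of `g`: `(n - 1) / 2` for `n` odd and `n / 2` for `n` even. -/
def degG (n : ℕ) : ℕ := if Odd n then (n - 1) / 2 else n / 2

/-- The degree of `h`: `(n - d) / 2` for `n` odd and `(n - d - 1) / 2` for `n` even.
It is used for `d` odd and `d ≤ n`, where the subtractions and divisions are exact. -/
def degH (d n : ℕ) : ℕ := if Odd n then (n - d) / 2 else (n - d - 1) / 2

/-- The rational function field `ℚ(a₀, …, a_{d_g}, b₀, …, b_{d_h})` in
`(d_g + 1) + (d_h + 1)` independent variables. -/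
abbrev ParamField (dg dh : ℕ) : Type :=
  FractionRing (MvPolynomial (Fin (dg + 1) ⊕ Fin (dh + 1)) ℚ)

/-- The variable `a_i` in `ℚ(a, b)`. -/
def a (dg dh : ℕ) (i : Fin (dg + 1)) : ParamField dg dh :=
  algebraMap (MvPolynomial (Fin (dg + 1) ⊕ Fin (dh + 1)) ℚ) (ParamField dg dh)
    (MvPolynomial.X (Sum.inl i))

/-- The variable `b_j` in `ℚ(a, b)`. -/
def b (dg dh : ℕ) (j : Fin (dh + 1)) : ParamField dg dh :=
  algebraMap (MvPolynomial (Fin (dg + 1) ⊕ Fin (dh + 1)) ℚ) (ParamField dg dh)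
    (MvPolynomial.X (Sum.inr j))

/-- The generic polynomial `g(x) = ∑_{i ≤ d_g} a_i x^i`. -/
def genericG (dg dh : ℕ) : (ParamField dg dh)[X] :=
  ∑ i : Fin (dg + 1), C (a dg dh i) * X ^ (i : ℕ)

/-- The generic polynomial `h(x) = ∑_{j ≤ d_h} b_j x^j`. -/
def genericH (dg dh : ℕ) : (ParamField dg dh)[X] :=
  ∑ j : Fin (dh + 1), C (b dg dh j) * X ^ (j : ℕ)

/-- The family `F_f = g(x)² - f(x) h(x)²` in `ℚ(a, b)[x]`. -/
def family (f : ℤ[X]) (dg dh : ℕ) : (ParamField dg dh)[X] :=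
  genericG dg dh ^ 2 - f.map (Int.castRingHom (ParamField dg dh)) * genericH dg dh ^ 2

end HyperellipticFamily

end

/-! It suffices to show that the Galois group has at least `n!` elements. Since `F_f` has degree at
most `n`, a group that large is the full symmetric group on `n` distinct roots, and its transitivity
gives irreducibility (`irreducible_and_gal_equiv_perm`).

The bound comes from degeneration: a specialization that keeps the degree cannot enlarge the Galois
group (`card_gal_specialization_le`). Rescaling `x` and letting the scale degenerate replaces `f` by
`x^d`, so that suitable monomial choices of `g` (up to a constant) and `h` lead to `(x^e - c)² -
x^(d+2j)` (`card_gal_degenerate_le`). The exponents `2e` and `d+2j` are `n` and `n-1` in some order,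
so the substitution `x = y²` produces the factor `y^n + y^(n-1) - c`, which splits in the same field
(`card_gal_trinom_le`).

For `c = t` over `ℚ(t)` this trinomial has group `S_n`. Two roots generate a rational function field
in their ratio, so the group is doubly transitive (`exists_algEquiv_of_roots`). Over the nonzero
critical value only two roots collide, so inertia contains a transposition. A primitive group
containing a transposition is symmetric (`factorial_le_card_gal_of_splits`). -/

namespace HyperellipticFamily

/-! ### Galois groups under base change and specialization -/

/-- The Galois group of a polynomial can only get smaller when the base field is enlarged. -/
theorem card_gal_map_le {F E : Type*} [Field F] [Field E] (i : F →+* E) (p : F[X]) :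
    Nat.card (p.map i).Gal ≤ Nat.card p.Gal := by
  let : Algebra F E := i.toAlgebra
  have : Fact ((p.map (algebraMap F (p.map i).SplittingField)).Splits) := ⟨by
    have h := SplittingField.splits (p.map i)
    rwa [Polynomial.map_map] at h⟩
  have hf : Function.Injective fun σ : (p.map i).Gal ↦
      Gal.restrict p (p.map i).SplittingField (AlgEquiv.restrictScalars F σ) := by
    intro σ τ h
    refine Gal.ext (p := p.map i) fun x hx ↦ ?_
    have hx' : x ∈ p.rootSet (p.map i).SplittingField := by
      rw [mem_rootSet'] at hx ⊢
      have e : algebraMap F (p.map i).SplittingField = (algebraMap E _).comp i := rfl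
      rw [Polynomial.map_map] at hx
      refine ⟨hx.1, ?_⟩
      have := hx.2
      rw [aeval_def, eval₂_map] at this
      rwa [aeval_def, e]
    have h1 := Gal.restrict_smul (AlgEquiv.restrictScalars F σ) ⟨x, hx'⟩
    have h2 := Gal.restrict_smul (AlgEquiv.restrictScalars F τ) ⟨x, hx'⟩
    simp only at h
    rw [h] at h1
    exact h1.symm.trans h2
  exact Nat.card_le_card_of_injective _ hf

/-- If a polynomial splits in a normal extension, its Galois group is a quotient of the
automorphism group of that extension. -/
theorem card_gal_le_of_splits {F E : Type*} [Field F] [Field E] [Algebra F E] [Normal F E]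
    [Finite Gal(E/F)] (p : F[X]) (h : (p.map (algebraMap F E)).Splits) :
    Nat.card p.Gal ≤ Nat.card Gal(E/F) := by
  have : Fact ((p.map (algebraMap F E)).Splits) := ⟨h⟩
  exact Nat.card_le_card_of_surjective _ (Gal.restrict_surjective p E)

/-- If `F` splits over the fraction field of an integrally closed domain `B`, its image in a field
under a homomorphism not killing the leading coefficient splits. -/
theorem splits_map_of_splits {A B L l : Type*} [CommRing A] [CommRing B] [Field L]
    [Field l] [Algebra A B] [Algebra A L] [Algebra B L] [IsScalarTower A B L]
    [IsIntegralClosure B A L] (F : A[X])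
    (hs : (F.map (algebraMap A L)).Splits) (ψ : B →+* l)
    (hlc : ψ (algebraMap A B F.leadingCoeff) ≠ 0) :
    (F.map (ψ.comp (algebraMap A B))).Splits := by
  classical
  have hlc' : algebraMap A L F.leadingCoeff ≠ 0 := by
    rw [IsScalarTower.algebraMap_apply A B L]
    intro h
    have := IsIntegralClosure.algebraMap_injective B A L (h.trans (map_zero (algebraMap B L)).symm)
    exact hlc (by rw [this, map_zero])
  have hFL : F.map (algebraMap A L) ≠ 0 := by
    intro h
    have := congrArg (coeff · F.natDegree) h
    simp only [coeff_map, coeff_zero] at this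
    exact hlc' this
  set u := algebraMap A B F.leadingCoeff with hu
  set R := (F.map (algebraMap A L)).roots with hR
  have hint : ∀ r ∈ R, ∃ b : B, algebraMap B L b = algebraMap A L F.leadingCoeff * r := by
    intro r hr
    have hr0 : aeval r F = 0 := by
      have := (mem_roots'.1 hr).2
      rwa [IsRoot, eval_map_algebraMap] at this
    have := isIntegral_leadingCoeff_smul F r hr0
    rw [Algebra.smul_def] at this
    exact (IsIntegralClosure.isIntegral_iff (A := B)).1 this
  choose! β hβ using hint
  -- The roots need not be integral, but their multiples by the leading coefficient are. Clearing
  -- denominators gives a factorization over `B` that can be pushed through `ψ`.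
  have key : C u ^ (Multiset.card R) * F.map (algebraMap A B) =
      C u * (R.map fun r ↦ C u * X - C (β r)).prod := by
    apply Polynomial.map_injective _ (IsIntegralClosure.algebraMap_injective B A L)
    have hlcm : (F.map (algebraMap A L)).leadingCoeff = algebraMap A L F.leadingCoeff :=
      leadingCoeff_map_of_leadingCoeff_ne_zero _ hlc'
    have hF := hs.eq_prod_roots
    rw [hlcm, ← hR] at hF
    simp only [Polynomial.map_mul, Polynomial.map_pow, map_C, Polynomial.map_map,
      ← IsScalarTower.algebraMap_eq, hu, ← IsScalarTower.algebraMap_apply]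
    rw [hF, Polynomial.map_multiset_prod, Multiset.map_map]
    have : (R.map ((Polynomial.map (algebraMap B L)) ∘ fun r ↦
        C (algebraMap A B F.leadingCoeff) * X - C (β r))) =
        R.map fun r ↦ C (algebraMap A L F.leadingCoeff) * (X - C r) := by
      refine Multiset.map_congr rfl fun r hr ↦ ?_
      simp [hβ r hr, mul_sub, ← IsScalarTower.algebraMap_apply]
    rw [this, Multiset.prod_map_mul, Multiset.map_const', Multiset.prod_replicate]
    ring
  have key' := congrArg (Polynomial.map ψ) key
  simp only [Polynomial.map_mul, Polynomial.map_pow, map_C, Polynomial.map_map] at key'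
  have hsp : (C (ψ u) * Polynomial.map ψ (R.map fun r ↦ C u * X - C (β r)).prod).Splits := by
    refine Splits.C_mul ?_ _
    rw [Polynomial.map_multiset_prod, Multiset.map_map]
    refine Splits.multisetProd fun q hq ↦ ?_
    obtain ⟨r, -, rfl⟩ := Multiset.mem_map.1 hq
    refine Splits.of_natDegree_le_one ?_
    simp only [Function.comp_apply, Polynomial.map_sub, Polynomial.map_mul, map_C, map_X]
    compute_degree
  rw [← key'] at hsp
  refine hsp.of_dvd ?_ (dvd_mul_left _ _)
  refine mul_ne_zero (pow_ne_zero _ (C_ne_zero.2 hlc)) fun h ↦ ?_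
  have := congrArg (coeff · F.natDegree) h
  simp only [coeff_map, coeff_zero] at this
  exact hlc this

/-- Specialization does not enlarge the Galois group. -/
theorem card_gal_specialization_le {A K L k : Type*} [CommRing A] [IsDomain A]
    [IsIntegrallyClosed A] [Field K] [Algebra A K] [IsFractionRing A K] [Field L] [Algebra K L]
    [Algebra A L] [IsScalarTower A K L]
    [FiniteDimensional K L] [IsGalois K L] [Field k] (φ : A →+* k) (F : A[X])
    (hlc : φ F.leadingCoeff ≠ 0) (hs : (F.map (algebraMap A L)).Splits) :
    Nat.card (F.map φ).Gal ≤ Nat.card Gal(L/K) := by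
  let B := integralClosure A L
  have : IsFractionRing B L := IsIntegralClosure.isFractionRing_of_finite_extension A K L B
  have hG : IsGaloisGroup Gal(L/K) A B := IsGaloisGroup.of_isFractionRing _ _ _ K L
  let P := RingHom.ker φ
  have hP : P.IsPrime := RingHom.ker_isPrime φ
  have hinj : Function.Injective (algebraMap A B) := by
    refine Function.Injective.of_comp (f := algebraMap B L) ?_
    rw [← RingHom.coe_comp, ← IsScalarTower.algebraMap_eq, IsScalarTower.algebraMap_eq A K L,
      RingHom.coe_comp]
    exact (algebraMap K L).injective.comp (IsFractionRing.injective A K)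
  obtain ⟨Q, -, hQ, hQP⟩ := Ideal.exists_ideal_over_prime_of_isIntegral (S := B) P ⊥ (by
    rw [← RingHom.ker_eq_comap_bot, (RingHom.injective_iff_ker_eq_bot _).mp hinj]
    exact bot_le)
  have hover : Q.LiesOver P := (Ideal.liesOver_iff _ _).2 hQP.symm
  let K' := FractionRing (A ⧸ P)
  let L' := FractionRing (B ⧸ Q)
  let : Algebra K' L' := FractionRing.liftAlgebra (A ⧸ P) L'
  have hn : Normal K' L' := Ideal.IsFractionRing.normal Gal(L/K) P Q K' L'
  -- The decomposition group of `Q` surjects onto the residual automorphism group, which bounds the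
  -- order of the latter.
  have hsurj := IsFractionRing.stabilizerHom_surjective Gal(L/K) P Q K' L'
  have : Finite Gal(L'/K') := Finite.of_surjective _ hsurj
  -- The residue field of `P` embeds in `k`, so the reduction of `F` modulo `P` is compared with
  -- `F.map φ` by base change.
  let i : K' →+* k := IsFractionRing.lift (A := A ⧸ P) (g := RingHom.kerLift φ) φ.kerLift_injective
  have hi : i.comp ((algebraMap (A ⧸ P) K').comp (algebraMap A (A ⧸ P))) = φ := by
    ext a
    simp only [RingHom.comp_apply, i, IsFractionRing.lift_algebraMap]
    exact RingHom.kerLift_mk φ a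
  set j := (algebraMap (A ⧸ P) K').comp (algebraMap A (A ⧸ P)) with hj
  have h1 : Nat.card (F.map φ).Gal ≤ Nat.card (F.map j).Gal := by
    rw [← hi, ← Polynomial.map_map]
    exact card_gal_map_le i _
  have hjL : (algebraMap K' L').comp j =
      ((algebraMap (B ⧸ Q) L').comp (algebraMap B (B ⧸ Q))).comp (algebraMap A B) := by
    rw [hj, ← RingHom.comp_assoc, ← IsScalarTower.algebraMap_eq (A ⧸ P) K' L',
      IsScalarTower.algebraMap_eq (A ⧸ P) (B ⧸ Q) L']
    rfl
  have h2 : ((F.map j).map (algebraMap K' L')).Splits := by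
    rw [Polynomial.map_map, hjL]
    refine splits_map_of_splits (L := L) F hs _ ?_
    rw [← RingHom.comp_apply _ (algebraMap A B), ← hjL, RingHom.comp_apply]
    intro h
    rw [map_eq_zero] at h
    exact hlc (by rw [← hi, RingHom.comp_apply, h, map_zero])
  refine h1.trans ((card_gal_le_of_splits _ h2).trans ?_)
  exact (Nat.card_le_card_of_surjective _ hsurj).trans (Subgroup.card_le_card_group _)

/-! ### The trinomial and its multiple roots -/

/-- The trinomial `x^(m+3) + x^(m+2) - c`. -/
noncomputable def trinom {R : Type*} [CommRing R] (m : ℕ) (c : R) : R[X] :=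
  X ^ (m + 3) + X ^ (m + 2) - C c

section trinom

variable {R : Type*} [CommRing R] (m : ℕ) (c : R)

theorem trinom_map {S : Type*} [CommRing S] (i : R →+* S) :
    (trinom m c).map i = trinom m (i c) := by
  simp [trinom]

theorem natDegree_trinom [Nontrivial R] : (trinom m c).natDegree = m + 3 := by
  unfold trinom
  compute_degree!

theorem monic_trinom [Nontrivial R] : (trinom m c).Monic := by
  unfold trinom
  monicity!

theorem eval_trinom (x : R) : (trinom m c).eval x = x ^ (m + 3) + x ^ (m + 2) - c := by
  simp [trinom]

theorem derivative_trinom :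
    derivative (trinom m c) = C (m + 3 : R) * X ^ (m + 2) + C (m + 2 : R) * X ^ (m + 1) := by
  simp only [trinom, derivative_sub, derivative_add, derivative_X_pow, derivative_C, sub_zero,
    Nat.cast_add, Nat.cast_ofNat]
  rfl

variable [IsDomain R] [CharZero R] {m c}

theorem natCast_mul_add_eq_zero_of_one_lt_count (hc : c ≠ 0) {x : R}
    (h : 1 < (trinom m c).rootMultiplicity x) : (m + 3 : R) * x + (m + 2) = 0 := by
  obtain ⟨h1, h2⟩ := (one_lt_rootMultiplicity_iff_isRoot (monic_trinom m c).ne_zero).1 h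
  rw [IsRoot, eval_trinom] at h1
  rw [IsRoot, derivative_trinom] at h2
  simp only [eval_add, eval_mul, eval_C, eval_pow, eval_X] at h2
  have hx : x ≠ 0 := by
    rintro rfl
    simp at h1
    exact hc h1
  have : x ^ (m + 1) * ((m + 3 : R) * x + (m + 2)) = 0 := by linear_combination h2
  exact (mul_eq_zero.1 this).resolve_left (pow_ne_zero _ hx)

/-- At a nonzero critical point the second derivative is `-(m+2) x^m`, which does not vanish. -/
theorem rootMultiplicity_trinom_le_two (hc : c ≠ 0) (x : R) :
    (trinom m c).rootMultiplicity x ≤ 2 := by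
  by_contra! h
  have h0 := natCast_mul_add_eq_zero_of_one_lt_count (m := m) hc (x := x) (by omega)
  have h2 := isRoot_iterate_derivative_of_lt_rootMultiplicity h
  have h1 := ((one_lt_rootMultiplicity_iff_isRoot (monic_trinom m c).ne_zero).1
    (lt_trans one_lt_two h)).1
  rw [IsRoot, eval_trinom] at h1
  have hx : x ≠ 0 := by
    rintro rfl
    simp at h1
    exact hc h1
  rw [Function.iterate_succ, Function.comp_apply, Function.iterate_one, derivative_trinom] at h2
  simp only [IsRoot, derivative_add, derivative_C_mul, derivative_X_pow, eval_add, eval_mul, eval_C,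
    eval_pow, eval_X, Nat.cast_add, Nat.cast_one, Nat.cast_ofNat, Nat.add_sub_cancel] at h2
  have e : m + 2 - 1 = m + 1 := rfl
  rw [e] at h2
  have : (m + 2 : R) * x ^ m = 0 := by
    linear_combination -h2 + (m + 2) * x ^ m * h0
  rcases mul_eq_zero.1 this with h | h
  · have : ((m + 2 : ℕ) : R) = 0 := by push_cast; exact h
    rw [Nat.cast_eq_zero] at this
    omega
  · exact pow_ne_zero _ hx h

variable [DecidableEq R]

/-- There is only one possible multiple root, the nonzero critical point, and it is at most double,
so counting roots without multiplicity loses at most one. -/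
theorem card_le_card_roots_trinom_add_one (hc : c ≠ 0) (hs : (trinom m c).Splits) :
    m + 3 ≤ (trinom m c).roots.toFinset.card + 1 := by
  have h := hs.natDegree_eq_card_roots
  rw [natDegree_trinom, ← Multiset.toFinset_sum_count_eq] at h
  rw [h]
  set T := (trinom m c).roots.toFinset
  have : ∀ x ∈ T, (trinom m c).roots.count x ≤
      1 + if (m + 3 : R) * x + (m + 2) = 0 then 1 else 0 := by
    intro x _
    rw [count_roots]
    split_ifs with hx
    · exact rootMultiplicity_trinom_le_two hc x
    · by_contra! h
      exact hx (natCast_mul_add_eq_zero_of_one_lt_count hc (by omega))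
  refine (Finset.sum_le_sum this).trans ?_
  rw [Finset.sum_add_distrib, Finset.sum_const, smul_eq_mul, mul_one, ← Finset.card_filter]
  refine Nat.add_le_add_left (Finset.card_le_one.2 fun x hx y hy ↦ ?_) _
  have hx := (Finset.mem_filter.1 hx).2
  have hy := (Finset.mem_filter.1 hy).2
  have h3 : (m + 3 : R) ≠ 0 := by exact_mod_cast (by omega : m + 3 ≠ 0)
  exact mul_left_cancel₀ h3 (by linear_combination hx - hy)

theorem card_roots_trinom (hc : c ≠ 0) (hs : (trinom m c).Splits)
    (h : ∀ x, (trinom m c).IsRoot x → (m + 3 : R) * x + (m + 2) ≠ 0) :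
    (trinom m c).roots.toFinset.card = m + 3 := by
  rw [Multiset.toFinset_card_of_nodup, ← hs.natDegree_eq_card_roots, natDegree_trinom]
  rw [Multiset.nodup_iff_count_le_one]
  intro x
  rw [count_roots]
  by_contra! h1
  refine h x ?_ (natCast_mul_add_eq_zero_of_one_lt_count hc h1)
  exact (rootMultiplicity_pos (monic_trinom m c).ne_zero).1 (by omega)

end trinom

/-! ### Double transitivity through the ratio of two roots -/

section twoTransitive

variable {L : Type*} [Field L] [CharZero L] {m : ℕ} {c : L}

/-- Writing `r' = u r` and subtracting the two equations leaves a linear equation for `r` over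
`ℚ(u)`. Its leading coefficient is nonzero, since `u^(m+3) = 1` would force `u^(m+2) = 1` and then
`u = 1`. -/
theorem root_eq_of_ratio (hc : c ≠ 0) {r r' : L} (h : (trinom m c).IsRoot r)
    (h' : (trinom m c).IsRoot r') (hne : r ≠ r') :
    r ≠ 0 ∧ r = -((r' / r) ^ (m + 2) - 1) / ((r' / r) ^ (m + 3) - 1) := by
  rw [IsRoot, eval_trinom] at h h'
  have hr : r ≠ 0 := by
    rintro rfl
    simp at h
    exact hc h
  refine ⟨hr, ?_⟩
  set u := r' / r with hu
  have hr' : r' = u * r := by rw [hu]; field_simp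
  have key : r ^ (m + 2) * (r * (u ^ (m + 3) - 1) + (u ^ (m + 2) - 1)) = 0 := by
    rw [hr'] at h'
    linear_combination h' - h
  have key' := (mul_eq_zero.1 key).resolve_left (pow_ne_zero _ hr)
  have hu1 : u ^ (m + 3) - 1 ≠ 0 := by
    intro h0
    rw [h0] at key'
    have h1 : u ^ (m + 2) = 1 := by linear_combination key'
    have : u = 1 := by
      have h2 : u ^ (m + 2) * u = 1 := by linear_combination h0
      rwa [h1, one_mul] at h2
    exact hne (by rw [hr', this, one_mul])
  rw [eq_div_iff hu1]
  linear_combination key'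

/-- The subfield of `L` generated by two distinct roots of `trinom m c` is a rational function
field in their ratio. -/
theorem exists_ratFunc_hom (hc : Transcendental ℚ c) {r r' : L} (h : (trinom m c).IsRoot r)
    (h' : (trinom m c).IsRoot r') (hne : r ≠ r') :
    ∃ τ : RatFunc ℚ →+* L, τ RatFunc.X = r' / r ∧
      τ (-(RatFunc.X ^ (m + 2) - 1) / (RatFunc.X ^ (m + 3) - 1)) = r := by
  have hc0 : c ≠ 0 := by
    rintro rfl
    exact hc isAlgebraic_zero
  obtain ⟨hr, hre⟩ := root_eq_of_ratio hc0 h h' hne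
  have hu : Transcendental ℚ (r' / r) := by
    intro hu
    have hr : IsAlgebraic ℚ r := by
      rw [hre, div_eq_mul_inv]
      exact ((hu.pow _).sub isAlgebraic_one).neg.mul ((hu.pow _).sub isAlgebraic_one).inv
    rw [IsRoot, eval_trinom, sub_eq_zero] at h
    exact hc (h ▸ (hr.pow _).add (hr.pow _))
  let τ : RatFunc ℚ →+* L := IsFractionRing.lift (A := ℚ[X]) (g := (aeval (r' / r)).toRingHom)
    (transcendental_iff_injective.1 hu)
  have hX : τ RatFunc.X = r' / r := by
    rw [← RatFunc.algebraMap_X, IsFractionRing.lift_algebraMap]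
    simp
  refine ⟨τ, hX, ?_⟩
  simp only [map_div₀, map_neg, map_sub, map_pow, map_one, hX]
  exact hre.symm

variable [Algebra ℚ[X] L]

omit [CharZero L] in
theorem algebraMap_polynomial_injective (K) [Field K] [Algebra ℚ[X] K] [IsFractionRing ℚ[X] K]
    [Algebra K L] [IsScalarTower ℚ[X] K L] : Function.Injective (algebraMap ℚ[X] L) := by
  rw [IsScalarTower.algebraMap_eq ℚ[X] K L, RingHom.coe_comp]
  exact (algebraMap K L).injective.comp (IsFractionRing.injective ℚ[X] K)

theorem polynomial_ringHom_ext {R : Type*} [Semiring R] {i j : ℚ[X] →+* R} (h : i X = j X) :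
    i = j :=
  Polynomial.ringHom_ext' (Subsingleton.elim _ _) h

theorem transcendental_algebraMap_X (K) [Field K] [Algebra ℚ[X] K] [IsFractionRing ℚ[X] K]
    [Algebra K L] [IsScalarTower ℚ[X] K L] : Transcendental ℚ (algebraMap ℚ[X] L X) := by
  rw [transcendental_iff_injective]
  have : (aeval (R := ℚ) (algebraMap ℚ[X] L X)).toRingHom = algebraMap ℚ[X] L :=
    polynomial_ringHom_ext (by simp)
  have h := algebraMap_polynomial_injective (L := L) K
  rw [← this] at h
  exact h

/-- The Galois group of `x^(m+3) + x^(m+2) - t` over `ℚ(t)` is doubly transitive on the roots. -/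
theorem exists_algEquiv_of_roots (K) [Field K] [Algebra ℚ[X] K] [IsFractionRing ℚ[X] K]
    [Algebra K L] [IsScalarTower ℚ[X] K L] [Normal K L]
    {r r' s s' : L} (hr : (trinom m (algebraMap ℚ[X] L X)).IsRoot r)
    (hr' : (trinom m (algebraMap ℚ[X] L X)).IsRoot r') (hne : r ≠ r')
    (hs : (trinom m (algebraMap ℚ[X] L X)).IsRoot s)
    (hs' : (trinom m (algebraMap ℚ[X] L X)).IsRoot s') (hne' : s ≠ s') :
    ∃ σ : Gal(L/K), σ r = s ∧ σ r' = s' := by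
  have hc := transcendental_algebraMap_X (L := L) K
  have hc0 : algebraMap ℚ[X] L X ≠ 0 := fun h ↦ hc (h ▸ isAlgebraic_zero)
  obtain ⟨τ, hτX, hτr⟩ := exists_ratFunc_hom hc hr hr' hne
  obtain ⟨υ, hυX, hυs⟩ := exists_ratFunc_hom hc hs hs' hne'
  have hr0 := (root_eq_of_ratio hc0 hr hr' hne).1
  have hs0 := (root_eq_of_ratio hc0 hs hs' hne').1
  set ρ : RatFunc ℚ := -(RatFunc.X ^ (m + 2) - 1) / (RatFunc.X ^ (m + 3) - 1) with hρ
  -- `t` is the same rational function of the ratio for every pair of distinct roots. Hence `τ` and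
  -- `υ` are both embeddings over `K` for one `K`-structure on `RatFunc ℚ`.
  let κ₀ : ℚ[X] →+* RatFunc ℚ := eval₂RingHom (algebraMap ℚ (RatFunc ℚ)) (ρ ^ (m + 3) + ρ ^ (m + 2))
  have h0 : κ₀ X = ρ ^ (m + 3) + ρ ^ (m + 2) := by simp [κ₀]
  rw [IsRoot, eval_trinom, sub_eq_zero] at hr hs
  have hτκ₀ : τ.comp κ₀ = algebraMap ℚ[X] L := polynomial_ringHom_ext (by
    rw [RingHom.comp_apply, h0, map_add, map_pow, map_pow, hτr, hr])
  have hυκ₀ : υ.comp κ₀ = algebraMap ℚ[X] L := polynomial_ringHom_ext (by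
    rw [RingHom.comp_apply, h0, map_add, map_pow, map_pow, hυs, hs])
  have hinj : Function.Injective κ₀ := by
    refine Function.Injective.of_comp (f := τ) ?_
    rw [← RingHom.coe_comp, hτκ₀]
    exact algebraMap_polynomial_injective K
  let κ : K →+* RatFunc ℚ := IsFractionRing.lift hinj
  have hκ : κ.comp (algebraMap ℚ[X] K) = κ₀ :=
    polynomial_ringHom_ext (IsFractionRing.lift_algebraMap hinj _)
  have hτκ : τ.comp κ = algebraMap K L :=
    IsLocalization.ringHom_ext (nonZeroDivisors ℚ[X]) (by
      rw [RingHom.comp_assoc, hκ, hτκ₀, ← IsScalarTower.algebraMap_eq])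
  have hυκ : υ.comp κ = algebraMap K L :=
    IsLocalization.ringHom_ext (nonZeroDivisors ℚ[X]) (by
      rw [RingHom.comp_assoc, hκ, hυκ₀, ← IsScalarTower.algebraMap_eq])
  let : Algebra K (RatFunc ℚ) := κ.toAlgebra
  let : Algebra (RatFunc ℚ) L := τ.toAlgebra
  have : IsScalarTower K (RatFunc ℚ) L := .of_algebraMap_eq' hτκ.symm
  let φ : RatFunc ℚ →ₐ[K] L := { υ with commutes' := fun x ↦ congrArg (· x) hυκ }
  -- Normality extends `υ` along `τ` to all of `L`; the extension carries the first pair of roots to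
  -- the second.
  let σ := AlgHom.liftNormal φ L
  have hσ : ∀ e : RatFunc ℚ, σ (τ e) = υ e := fun e ↦ AlgHom.liftNormal_commutes φ L e
  refine ⟨AlgEquiv.ofBijective σ (AlgHom.normal_bijective K L L σ), ?_, ?_⟩
  · change σ r = s
    rw [← hτr, hσ, hυs]
  · change σ r' = s'
    have e1 : r' = τ RatFunc.X * τ ρ := by rw [hτX, hτr]; field_simp
    rw [e1, map_mul, hσ, hσ, hυX, hυs]
    field_simp

end twoTransitive

/-! ### Ramification over the nonzero critical value -/

/-- The nonzero critical point of `x^(m+3) + x^(m+2)`. -/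
def critPt (m : ℕ) : ℚ := -(m + 2) / (m + 3)

/-- The nonzero critical value of `x^(m+3) + x^(m+2)`. -/
def critVal (m : ℕ) : ℚ := critPt m ^ (m + 3) + critPt m ^ (m + 2)

theorem critPt_mul (m : ℕ) : (m + 3 : ℚ) * critPt m + (m + 2) = 0 := by
  unfold critPt
  field_simp
  ring

theorem critPt_ne_zero (m : ℕ) : critPt m ≠ 0 := by
  intro h
  have := critPt_mul m
  rw [h, mul_zero, zero_add] at this
  have h2 : (0 : ℚ) < m + 2 := by positivity
  exact h2.ne' this

theorem critVal_ne_zero (m : ℕ) : critVal m ≠ 0 := by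
  intro h
  have h1 : critPt m ^ (m + 2) * (critPt m + 1) = 0 := by rw [← h, critVal]; ring
  have h2 := (mul_eq_zero.1 h1).resolve_left (pow_ne_zero _ (critPt_ne_zero m))
  have h3 := critPt_mul m
  have : (1 : ℚ) = 0 := by linear_combination (m + 3 : ℚ) * h2 - h3
  exact one_ne_zero this

theorem sq_dvd_trinom_critVal (m : ℕ) :
    (X - C (critPt m)) ^ 2 ∣ trinom m (critVal m) := by
  rw [← le_rootMultiplicity_iff (monic_trinom _ _).ne_zero]
  refine (one_lt_rootMultiplicity_iff_isRoot (monic_trinom _ _).ne_zero).2 ⟨?_, ?_⟩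
  · rw [IsRoot, eval_trinom, critVal, sub_self]
  · rw [IsRoot, derivative_trinom]
    simp only [eval_add, eval_mul, eval_C, eval_pow, eval_X]
    linear_combination critPt m ^ (m + 1) * critPt_mul m

theorem exists_trinom_critVal_eq (m : ℕ) {R : Type*} [CommRing R] (i : ℚ →+* R) (x : R) :
    ∃ y, x ^ (m + 3) + x ^ (m + 2) - i (critVal m) = (x - i (critPt m)) ^ 2 * y := by
  obtain ⟨w, hw⟩ := sq_dvd_trinom_critVal m
  refine ⟨w.eval₂ i x, ?_⟩
  have := congrArg (eval₂ i x) hw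
  simpa [trinom, eval₂_mul, eval₂_pow, eval₂_sub] using this

section inertia

variable {S : Type*} [CommRing S] [Algebra ℚ[X] S] {m : ℕ}

/-- The ideal of `ℚ[t]` of polynomials vanishing at the nonzero critical value. -/
noncomputable def critIdeal (m : ℕ) : Ideal ℚ[X] := RingHom.ker (evalRingHom (critVal m))

instance (m : ℕ) : (critIdeal m).IsMaximal :=
  RingHom.ker_isMaximal_of_surjective _ fun x ↦ ⟨C x, by simp⟩

theorem mem_critIdeal (m : ℕ) : (X - C (critVal m) : ℚ[X]) ∈ critIdeal m := by
  simp [critIdeal, RingHom.mem_ker]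

theorem critIdeal_le {I : Ideal ℚ[X]} (h : (X - C (critVal m) : ℚ[X]) ∈ I) : critIdeal m ≤ I := by
  intro p hp
  have : IsRoot p (critVal m) := by simpa [critIdeal, RingHom.mem_ker] using hp
  obtain ⟨q, rfl⟩ := dvd_iff_isRoot.2 this
  exact I.mul_mem_right _ h

/-- Some root `r` is congruent to the critical point modulo `Q`, and `t` minus the critical value is
divisible by the square of `r` minus the critical point. Thus `Q` is ramified. -/
theorem map_critIdeal_le_sq [IsDomain S]
    (hs : ((trinom m (X : ℚ[X])).map (algebraMap ℚ[X] S)).Splits)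
    (Q : Ideal S) [Q.IsPrime] [Q.LiesOver (critIdeal m)] :
    (critIdeal m).map (algebraMap ℚ[X] S) ≤ Q ^ 2 := by
  have hmem : algebraMap ℚ[X] S (X - C (critVal m)) ∈ Q := by
    have := mem_critIdeal m
    rw [Ideal.LiesOver.over (P := Q) (p := critIdeal m)] at this
    exact this
  let i : ℚ →+* S := (algebraMap ℚ[X] S).comp C
  rw [trinom_map] at hs
  -- The product of the differences between the critical point and the roots equals the critical
  -- value minus `t`, which lies in `Q`; primality then selects a factor.
  have h1 := hs.eval_eq_prod_roots_of_monic (monic_trinom _ _) (i (critPt m))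
  have h2 : (trinom m (algebraMap ℚ[X] S X)).eval (i (critPt m)) ∈ Q := by
    have : (trinom m (algebraMap ℚ[X] S X)).eval (i (critPt m)) =
        -algebraMap ℚ[X] S (X - C (critVal m)) := by
      rw [eval_trinom, map_sub, neg_sub]
      change _ = i (critVal m) - _
      rw [critVal]
      simp only [map_add, map_pow]
    rw [this]
    exact Q.neg_mem hmem
  rw [h1, Ideal.IsPrime.multiset_prod_mem_iff_exists_mem ‹Q.IsPrime›] at h2
  obtain ⟨y, hy, hyQ⟩ := h2
  obtain ⟨r, hr, rfl⟩ := Multiset.mem_map.1 hy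
  have hr' := (mem_roots'.1 hr).2
  rw [IsRoot, eval_trinom, sub_eq_zero] at hr'
  obtain ⟨w, hw⟩ := exists_trinom_critVal_eq m i r
  rw [Ideal.map_le_iff_le_comap]
  refine critIdeal_le ?_
  rw [Ideal.mem_comap, map_sub, ← hr']
  change _ - i (critVal m) ∈ _
  rw [hw]
  refine Ideal.mul_mem_right _ _ (Ideal.pow_mem_pow ?_ 2)
  rw [← neg_sub]
  exact Q.neg_mem hyQ

theorem le_ncard_rootSet_quotient
    (hs : ((trinom m (X : ℚ[X])).map (algebraMap ℚ[X] S)).Splits)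
    (Q : Ideal S) [Q.IsPrime] [Q.LiesOver (critIdeal m)] :
    m + 3 ≤ ((trinom m (X : ℚ[X])).rootSet (S ⧸ Q)).ncard + 1 := by
  classical
  let i : ℚ →+* S ⧸ Q := (algebraMap ℚ[X] (S ⧸ Q)).comp C
  have hi : Function.Injective i := i.injective
  have : CharZero (S ⧸ Q) := charZero_of_injective_ringHom hi
  have hX : algebraMap ℚ[X] (S ⧸ Q) X = i (critVal m) := by
    rw [← sub_eq_zero]
    change algebraMap ℚ[X] (S ⧸ Q) X - algebraMap ℚ[X] (S ⧸ Q) (C (critVal m)) = 0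
    rw [← map_sub]
    have := mem_critIdeal m
    rw [Ideal.LiesOver.over (P := Q) (p := critIdeal m)] at this
    exact Ideal.Quotient.eq_zero_iff_mem.2 this
  have hc : algebraMap ℚ[X] (S ⧸ Q) X ≠ 0 := by
    rw [hX, map_ne_zero_iff _ hi]
    exact critVal_ne_zero m
  have hs' : (trinom m (algebraMap ℚ[X] (S ⧸ Q) X)).Splits := by
    have := hs.map (Ideal.Quotient.mk Q)
    rw [Polynomial.map_map, trinom_map] at this
    exact this
  rw [rootSet_def, aroots_def, trinom_map, Set.ncard_coe_finset]
  exact card_le_card_roots_trinom_add_one hc hs'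

/-- A multiple root would be the constant critical point, forcing the variable `t` to equal the
critical value. -/
theorem ncard_rootSet_trinom [IsDomain S] (hinj : Function.Injective (algebraMap ℚ[X] S))
    (hs : ((trinom m (X : ℚ[X])).map (algebraMap ℚ[X] S)).Splits) :
    ((trinom m (X : ℚ[X])).rootSet S).ncard = m + 3 := by
  classical
  let i : ℚ →+* S := (algebraMap ℚ[X] S).comp C
  have hi : Function.Injective i := i.injective
  have : CharZero S := charZero_of_injective_ringHom hi
  have hc : algebraMap ℚ[X] S X ≠ 0 := by
    rw [map_ne_zero_iff _ hinj]
    exact X_ne_zero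
  rw [trinom_map] at hs
  rw [rootSet_def, aroots_def, trinom_map, Set.ncard_coe_finset]
  refine card_roots_trinom hc hs fun x hx h ↦ ?_
  have h1 : x = i (critPt m) := by
    have h3 : (m + 3 : S) ≠ 0 := by exact_mod_cast (by omega : m + 3 ≠ 0)
    have h4 := congrArg i (critPt_mul m)
    simp only [map_add, map_mul, map_natCast, map_ofNat, map_zero] at h4
    exact mul_left_cancel₀ h3 (by linear_combination h - h4)
  rw [IsRoot, eval_trinom, h1, ← map_pow, ← map_pow, ← map_add, sub_eq_zero] at hx
  have h5 : C (critVal m) = (X : ℚ[X]) := hinj hx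
  have := congrArg natDegree h5
  simp at this

end inertia

/-- Residue extensions are then separable, as needed to equate the order of inertia with the
ramification index. -/
instance (m : ℕ) : PerfectField (critIdeal m).ResidueField := by
  have : CharZero (critIdeal m).ResidueField :=
    charZero_of_injective_ringHom
      ((algebraMap ℚ[X] (critIdeal m).ResidueField).comp C).injective
  infer_instance

/-! ### The Galois group of the trinomial -/

section galois

variable {L : Type*} [Field L] [CharZero L] [Algebra ℚ[X] L] {m : ℕ}

/-- The full symmetric group acts on the roots of `x^(m+3) + x^(m+2) - t` over `ℚ(t)`. -/
theorem factorial_le_card_gal_of_splits (K) [Field K] [Algebra ℚ[X] K] [IsFractionRing ℚ[X] K]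
    [Algebra K L] [IsScalarTower ℚ[X] K L] [FiniteDimensional K L] [IsGalois K L]
    (hs : ((trinom m (X : ℚ[X])).map (algebraMap ℚ[X] L)).Splits)
    (hfaith : ∀ σ : Gal(L/K),
      (∀ r, (trinom m (algebraMap ℚ[X] L X)).IsRoot r → σ r = r) → σ = 1) :
    (m + 3).factorial ≤ Nat.card Gal(L/K) := by
  classical
  let S := integralClosure ℚ[X] L
  have : IsFractionRing S L := IsIntegralClosure.isFractionRing_of_finite_extension ℚ[X] K L S
  have hG : IsGaloisGroup Gal(L/K) ℚ[X] S := IsGaloisGroup.of_isFractionRing _ _ _ K L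
  have : IsDedekindDomain S := IsIntegralClosure.isDedekindDomain ℚ[X] K L S
  have : Module.Finite ℚ[X] S := IsIntegralClosure.finite ℚ[X] K L S
  have hinjL : Function.Injective (algebraMap ℚ[X] L) := algebraMap_polynomial_injective K
  have hinj : Function.Injective (algebraMap ℚ[X] S) := by
    refine Function.Injective.of_comp (f := algebraMap S L) ?_
    rw [← RingHom.coe_comp, ← IsScalarTower.algebraMap_eq]
    exact hinjL
  have : FaithfulSMul ℚ[X] S := (faithfulSMul_iff_algebraMap_injective _ _).2 hinj
  set f := trinom m (X : ℚ[X]) with hf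
  have hsS : (f.map (algebraMap ℚ[X] S)).Splits := by
    refine Splits.of_splits_map_of_injective (FaithfulSMul.algebraMap_injective S L) ?_ ?_
    · rwa [Polynomial.map_map, ← IsScalarTower.algebraMap_eq]
    · intro a ha
      rw [Polynomial.map_map, ← IsScalarTower.algebraMap_eq] at ha
      refine ⟨⟨a, f, monic_trinom m X, ?_⟩, rfl⟩
      rw [← eval_map]
      exact (mem_roots'.1 ha).2
  obtain ⟨Q, hQ, hover⟩ := Ideal.exists_maximal_ideal_liesOver_of_isIntegral (S := S) (critIdeal m)
  have hroot : ∀ x : S, x ∈ f.rootSet S ↔ (trinom m (algebraMap ℚ[X] L X)).IsRoot (x : L) := by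
    intro x
    rw [mem_rootSet', IsRoot, ← trinom_map m X (algebraMap ℚ[X] L), ← hf, eval_map_algebraMap]
    have h1 : f.map (algebraMap ℚ[X] S) ≠ 0 := ((monic_trinom m X).map _).ne_zero
    have h2 : aeval (x : L) f = algebraMap S L (aeval x f) := aeval_algebraMap_apply L x f
    rw [h2, map_eq_zero_iff _ (FaithfulSMul.algebraMap_injective S L)]
    exact ⟨fun h ↦ h.2, fun h ↦ ⟨h1, h⟩⟩
  -- a nontrivial element of inertia
  have hne : Nat.card (Q.inertia Gal(L/K)) ≠ 1 := by
    rw [Ideal.card_inertia_eq_ramificationIdxIn (critIdeal m) Q,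
      Ideal.ramificationIdxIn_eq_ramificationIdx (critIdeal m) Q Gal(L/K),
      ← Ideal.ramificationIdx'_eq_ramificationIdx (critIdeal m) Q, Ideal.ramificationIdx'_ne_one_iff]
    · exact map_critIdeal_le_sq hsS Q
    · exact (map_critIdeal_le_sq hsS Q).trans (Ideal.pow_le_self two_ne_zero)
    · intro h
      have := mem_critIdeal m
      rw [h, Ideal.mem_bot] at this
      exact X_sub_C_ne_zero _ this
  obtain ⟨g, hg, hg1⟩ : ∃ g ∈ Q.inertia Gal(L/K), g ≠ 1 := by
    by_contra! h
    exact hne (Subgroup.card_eq_one.2 ((Subgroup.eq_bot_iff_forall _).2 h))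
  have hncard := ncard_rootSet_trinom hinj hsS
  -- Inertia fixes every root modulo `Q`, and reduction identifies at most one pair of roots.
  have hswap := hsS.toPermHom_apply_eq_one_or_isSwap_of_ncard_le_of_mem_inertia Q
    (hncard.le.trans (le_ncard_rootSet_quotient hsS Q)) g hg
  have hg2 : MulAction.toPermHom Gal(L/K) (f.rootSet S) g ≠ 1 := by
    intro h
    refine hg1 (hfaith g fun r hr ↦ ?_)
    have hint : IsIntegral ℚ[X] r := ⟨f, monic_trinom m X, by
      rw [IsRoot, ← trinom_map m X (algebraMap ℚ[X] L), eval_map_algebraMap] at hr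
      exact hr⟩
    have h1 := Equiv.Perm.ext_iff.1 h ⟨⟨r, hint⟩, (hroot ⟨r, hint⟩).2 hr⟩
    exact congrArg (fun x : f.rootSet S ↦ ((x : S) : L)) h1
  have hswap := hswap.resolve_left hg2
  have hprim : MulAction.IsPreprimitive
      (MulAction.toPermHom Gal(L/K) (f.rootSet S)).range (f.rootSet S) := by
    refine MulAction.isPreprimitive_of_is_two_pretransitive
      (MulAction.is_two_pretransitive_iff.2 fun {a b c d} hab hcd ↦ ?_)
    have e : ∀ {x y : f.rootSet S}, x ≠ y → ((x : S) : L) ≠ ((y : S) : L) :=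
      fun h h' ↦ h (Subtype.ext (Subtype.ext h'))
    obtain ⟨σ, h1, h2⟩ := exists_algEquiv_of_roots K ((hroot _).1 a.2) ((hroot _).1 b.2) (e hab)
      ((hroot _).1 c.2) ((hroot _).1 d.2) (e hcd)
    exact ⟨⟨_, σ, rfl⟩, Subtype.ext (Subtype.ext h1), Subtype.ext (Subtype.ext h2)⟩
  have hfin : Finite (f.rootSet S) := (f.rootSet_finite S).to_subtype
  have htop := Equiv.Perm.subgroup_eq_top_of_isPreprimitive_of_isSwap_mem hprim _ hswap ⟨g, rfl⟩
  have := Nat.card_le_card_of_surjective _ (MonoidHom.range_eq_top.1 htop)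
  rwa [Nat.card_perm, Nat.card_coe_set_eq, hncard] at this

end galois

theorem isGalois_splittingField {K : Type*} [Field K] [CharZero K] (p : K[X]) :
    IsGalois K p.SplittingField :=
  have := Normal.of_isSplittingField (E := p.SplittingField) p
  ⟨⟩

theorem factorial_le_card_gal_trinom (K : Type*) [Field K] [Algebra ℚ[X] K]
    [IsFractionRing ℚ[X] K] (m : ℕ) :
    (m + 3).factorial ≤ Nat.card (trinom m (algebraMap ℚ[X] K X)).Gal := by
  have : CharZero K := charZero_of_injective_ringHom ((algebraMap ℚ[X] K).comp C).injective
  set p := trinom m (algebraMap ℚ[X] K X) with hp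
  have : CharZero p.SplittingField := charZero_of_injective_algebraMap (algebraMap K _).injective
  have := isGalois_splittingField p
  have e : (trinom m (X : ℚ[X])).map (algebraMap ℚ[X] p.SplittingField) =
      p.map (algebraMap K p.SplittingField) := by
    rw [hp, trinom_map, trinom_map, ← IsScalarTower.algebraMap_apply]
  refine factorial_le_card_gal_of_splits (L := p.SplittingField) K ?_ fun σ hσ ↦ ?_
  · rw [e]
    exact SplittingField.splits p
  · refine Gal.ext (p := p) fun x hx ↦ hσ x ?_
    have := (mem_rootSet'.1 hx).2
    rw [← eval_map_algebraMap, ← e, trinom_map] at this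
    exact this

/-! ### From the group order to irreducibility -/

/-- A polynomial of degree at most `n ≥ 2` whose Galois group has at least `n!` elements is
irreducible with the symmetric group as Galois group. -/
theorem irreducible_and_gal_equiv_perm {K : Type*} [Field K] {p : K[X]} {n : ℕ} (hn : 2 ≤ n)
    (hp : p.natDegree ≤ n) (hcard : n.factorial ≤ Nat.card p.Gal) :
    Irreducible p ∧ Nonempty (p.Gal ≃* Equiv.Perm (Fin n)) := by
  classical
  set T := p.rootSet p.SplittingField with hT
  have hfin : Finite T := (p.rootSet_finite p.SplittingField).to_subtype
  let θ : p.Gal →* Equiv.Perm T := MulAction.toPermHom p.Gal T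
  have hθ : Function.Injective θ := by
    intro σ τ h
    refine Gal.ext (p := p) fun x hx ↦ ?_
    exact congrArg (Subtype.val) (Equiv.Perm.ext_iff.1 h ⟨x, hx⟩)
  have hle : ∀ q : K[X], (q.rootSet p.SplittingField).ncard ≤ q.natDegree := by
    intro q
    rw [rootSet_def, Set.ncard_coe_finset]
    exact (Multiset.toFinset_card_le _).trans ((card_roots' _).trans natDegree_map_le)
  have hTn : Nat.card T ≤ p.natDegree := by
    rw [Nat.card_coe_set_eq]
    exact hle p
  have h1 : n.factorial ≤ (Nat.card T).factorial := by
    rw [← Nat.card_perm]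
    exact hcard.trans (Nat.card_le_card_of_injective _ hθ)
  have hnT : n ≤ Nat.card T := by
    by_contra! h
    -- The empty root set is treated apart because `0! = 1!` breaks strict monotonicity of the
    -- factorial.
    rcases Nat.eq_zero_or_pos (Nat.card T) with h0 | h0
    · rw [h0, Nat.factorial_zero] at h1
      have := Nat.self_le_factorial n
      omega
    · exact absurd h1 (not_le.2 ((Nat.factorial_lt h0).2 h))
  have hT' : Nat.card T = n := le_antisymm (hTn.trans hp) hnT
  have hbij : Function.Bijective θ := by
    refine (Nat.bijective_iff_injective_and_card θ).2 ⟨hθ, le_antisymm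
      (Nat.card_le_card_of_injective _ hθ) ?_⟩
    rw [Nat.card_perm, hT']
    exact hcard
  refine ⟨?_, ⟨(MulEquiv.ofBijective θ hbij).trans
    (Equiv.permCongrHom (Finite.equivFinOfCardEq hT'))⟩⟩
  have hne : Nonempty T := (Nat.card_pos_iff.1 (by omega)).1
  obtain ⟨r⟩ := hne
  have hr := (mem_rootSet'.1 r.2).2
  have hp0 : p ≠ 0 := by
    rintro rfl
    rw [natDegree_zero] at hTn
    omega
  have hint : IsIntegral K (r : p.SplittingField) := Algebra.IsIntegral.isIntegral _
  obtain ⟨w, hw⟩ := minpoly.dvd K _ hr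
  -- Every transposition is realized, so all roots are conjugate to `r` and its minimal polynomial
  -- already has degree `n`.
  have hsub : T ⊆ (minpoly K (r : p.SplittingField)).rootSet p.SplittingField := by
    intro s hs
    obtain ⟨σ, hσ⟩ := hbij.2 (Equiv.swap r ⟨s, hs⟩)
    have h2 : σ r = s := by
      have := congrArg Subtype.val (Equiv.Perm.ext_iff.1 hσ r)
      rw [Equiv.swap_apply_left] at this
      exact this
    rw [mem_rootSet]
    refine ⟨minpoly.ne_zero hint, ?_⟩
    rw [← h2]
    change aeval (AlgEquiv.toAlgHom (σ : Gal(p.SplittingField/K)) (r : p.SplittingField)) _ = 0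
    rw [aeval_algHom_apply, minpoly.aeval, map_zero]
  have h3 : n ≤ (minpoly K (r : p.SplittingField)).natDegree := by
    refine le_trans ?_ (hle _)
    rw [← hT', Nat.card_coe_set_eq]
    exact Set.ncard_le_ncard hsub (rootSet_finite _ _)
  have hw0 : w ≠ 0 := by
    rintro rfl
    exact hp0 (by rw [hw, mul_zero])
  have h4 := natDegree_mul (minpoly.ne_zero hint) hw0
  rw [← hw] at h4
  have hwu : IsUnit w := isUnit_iff_degree_eq_zero.2 (by
    rw [degree_eq_natDegree hw0, show w.natDegree = 0 by omega, Nat.cast_zero])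
  rw [hw]
  exact (irreducible_mul_isUnit hwu).2 (minpoly.irreducible hint)

/-! ### Passing from the squares of the roots to the trinomial -/

/-- The roots of `(x^e - c)² - x^q` are the squares of the roots of a trinomial, and generate the
same extension. -/
theorem card_gal_trinom_le {k : Type*} [Field k] {c : k} (hc : c ≠ 0) {m e q : ℕ}
    (h : q = m + 3 ∧ 2 * e = m + 2 ∨ 2 * e = m + 3 ∧ q = m + 2) :
    Nat.card (trinom m c).Gal ≤ Nat.card ((X ^ e - C c) ^ 2 - X ^ q : k[X]).Gal := by
  set p : k[X] := (X ^ e - C c) ^ 2 - X ^ q with hp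
  let M := p.SplittingField
  have hnor : Normal k M := Normal.of_isSplittingField p
  refine card_gal_le_of_splits (E := M) _ ?_
  rw [trinom_map]
  set d := algebraMap k M c with hd
  have hd0 : d ≠ 0 := (_root_.map_ne_zero _).2 hc
  let N := AlgebraicClosure M
  refine Splits.of_splits_map (algebraMap M N) (IsAlgClosed.splits _) fun a ha ↦ ?_
  rw [trinom_map] at ha
  have ha := (mem_roots'.1 ha).2
  rw [IsRoot, eval_trinom, sub_eq_zero] at ha
  set D := algebraMap M N d with hD
  have hD0 : D ≠ 0 := (_root_.map_ne_zero _).2 hd0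
  have ha0 : a ≠ 0 := by
    rintro rfl
    rw [zero_pow (by omega), zero_pow (by omega), add_zero] at ha
    exact hD0 ha.symm
  have hpM : p.map (algebraMap k M) = (X ^ e - C d) ^ 2 - X ^ q := by
    simp [hp, hd]
  have hp0 : p ≠ 0 := by
    intro h0
    have h1 : q ≠ 2 * e := by omega
    have h2 := congrArg (eval 0) h0
    simp only [hp, eval_sub, eval_pow, eval_X, eval_C, eval_zero] at h2
    rw [zero_pow (by omega), zero_pow (by omega), zero_sub, sub_zero, neg_sq] at h2
    exact hc (pow_eq_zero_iff two_ne_zero |>.1 h2)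
  have hroot : ((p.map (algebraMap k M)).map (algebraMap M N)).IsRoot (a ^ 2) := by
    rw [hpM]
    simp only [IsRoot, Polynomial.map_sub, Polynomial.map_pow, map_X, map_C, eval_sub, eval_pow,
      eval_X, eval_C, ← pow_mul]
    rw [← hD, ← ha]
    rcases h with ⟨rfl, h⟩ | ⟨h, rfl⟩ <;> rw [h] <;> ring
  obtain ⟨y, hy⟩ := (SplittingField.splits p).mem_range_of_isRoot
    (by rwa [Polynomial.map_ne_zero_iff (algebraMap k _).injective]) hroot
  -- With `y = a²`, the trinomial equation recovers `a` as `a^(m+3) / a^(m+2)` in the first case and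
  -- as `a^(m+2) / a^(m+1)` in the second; numerator and denominator are expressed through `d` and
  -- `y`.
  rcases h with ⟨-, h⟩ | ⟨h, -⟩
  · refine ⟨(d - y ^ e) / y ^ e, ?_⟩
    rw [map_div₀, map_sub, map_pow, hy, ← hD, ← ha, ← pow_mul, h]
    rw [div_eq_iff (pow_ne_zero _ ha0)]
    ring
  · obtain ⟨j, rfl⟩ : ∃ j, e = j + 1 := ⟨e - 1, by omega⟩
    refine ⟨(d - y ^ (j + 1)) / y ^ j, ?_⟩
    rw [map_div₀, map_sub, map_pow, map_pow, hy, ← hD, ← ha, ← pow_mul, h, ← pow_mul,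
      show m + 2 = 2 * j + 1 by omega]
    rw [div_eq_iff (pow_ne_zero _ ha0)]
    ring

/-! ### Specializing the parameters -/

/-- `(∑ αᵢ xⁱ)² - f (∑ βⱼ xʲ)²` for arbitrary coefficients. -/
noncomputable def member {R : Type*} [CommRing R] (f : ℤ[X]) {dg dh : ℕ} (α : Fin (dg + 1) → R)
    (β : Fin (dh + 1) → R) : R[X] :=
  (∑ i, C (α i) * X ^ (i : ℕ)) ^ 2 -
    f.map (Int.castRingHom R) * (∑ j, C (β j) * X ^ (j : ℕ)) ^ 2

theorem member_map {R S : Type*} [CommRing R] [CommRing S] (i : R →+* S) (f : ℤ[X]) {dg dh : ℕ}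
    (α : Fin (dg + 1) → R) (β : Fin (dh + 1) → R) :
    (member f α β).map i = member f (i ∘ α) (i ∘ β) := by
  have : i.comp (Int.castRingHom R) = Int.castRingHom S := Subsingleton.elim _ _
  simp [member, Polynomial.map_sum, Polynomial.map_map, this]

theorem family_eq_map (f : ℤ[X]) (dg dh : ℕ) :
    family f dg dh = (member f (fun i ↦ MvPolynomial.X (Sum.inl i))
      (fun j ↦ MvPolynomial.X (Sum.inr j)) :
        (MvPolynomial (Fin (dg + 1) ⊕ Fin (dh + 1)) ℚ)[X]).map
      (algebraMap _ (ParamField dg dh)) := by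
  rw [member_map]
  rfl

theorem natDegree_sum_fin_le {R : Type*} [CommRing R] {d : ℕ} (α : Fin (d + 1) → R) :
    (∑ i, C (α i) * X ^ (i : ℕ)).natDegree ≤ d :=
  natDegree_sum_le_of_forall_le _ _ fun i _ ↦
    (natDegree_C_mul_X_pow_le _ _).trans (Nat.le_of_lt_succ i.2)

theorem natDegree_member_le {R : Type*} [CommRing R] (f : ℤ[X]) {dg dh n : ℕ}
    (α : Fin (dg + 1) → R) (β : Fin (dh + 1) → R) (h1 : 2 * dg ≤ n)
    (h2 : f.natDegree + 2 * dh ≤ n) : (member f α β).natDegree ≤ n := by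
  refine (natDegree_sub_le _ _).trans (max_le ?_ ?_)
  · exact natDegree_pow_le.trans ((Nat.mul_le_mul_left 2 (natDegree_sum_fin_le α)).trans h1)
  · refine natDegree_mul_le.trans ((add_le_add natDegree_map_le (natDegree_pow_le.trans
      (Nat.mul_le_mul_left 2 (natDegree_sum_fin_le β)))).trans h2)

theorem map_leadingCoeff_ne_zero {R S : Type*} [CommRing R] [CommRing S] (i : R →+* S) {F : R[X]}
    (h : F.natDegree ≤ (F.map i).natDegree) (h0 : F.map i ≠ 0) : i F.leadingCoeff ≠ 0 := by
  rw [leadingCoeff, le_antisymm h natDegree_map_le, ← coeff_map]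
  exact leadingCoeff_ne_zero.2 h0

/-- Specializing the parameters without lowering the degree does not enlarge the Galois group. -/
theorem card_gal_member_le {k : Type*} [Field k] [CharZero k] (f : ℤ[X]) {dg dh n : ℕ}
    (α : Fin (dg + 1) → k) (β : Fin (dh + 1) → k) (h1 : 2 * dg ≤ n)
    (h2 : f.natDegree + 2 * dh ≤ n) (h3 : n ≤ (member f α β).natDegree) (hn : n ≠ 0) :
    Nat.card (member f α β).Gal ≤ Nat.card (family f dg dh).Gal := by
  let A := MvPolynomial (Fin (dg + 1) ⊕ Fin (dh + 1)) ℚ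
  let φ : A →+* k := MvPolynomial.eval₂Hom (algebraMap ℚ k) (Sum.elim α β)
  set F : A[X] := member f (fun i ↦ MvPolynomial.X (Sum.inl i))
      (fun j ↦ MvPolynomial.X (Sum.inr j)) with hF
  have hφ : F.map φ = member f α β := by
    rw [hF, member_map]
    congr 1 <;> ext i <;> exact MvPolynomial.eval₂Hom_X' _ _ _
  have := isGalois_splittingField (family f dg dh)
  rw [← hφ] at h3 ⊢
  refine card_gal_specialization_le (K := ParamField dg dh) (L := (family f dg dh).SplittingField)
    φ F ?_ ?_
  · refine map_leadingCoeff_ne_zero φ ((natDegree_member_le f _ _ h1 h2).trans h3) ?_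
    intro h0
    rw [h0, natDegree_zero] at h3
    omega
  · have := SplittingField.splits (family f dg dh)
    rwa [family_eq_map, Polynomial.map_map, ← family_eq_map,
      ← IsScalarTower.algebraMap_eq] at this

theorem sum_fin_coeff {R : Type*} [CommRing R] {p : R[X]} {d : ℕ} (h : p.natDegree ≤ d) :
    ∑ i : Fin (d + 1), C (p.coeff i) * X ^ (i : ℕ) = p := by
  rw [Fin.sum_univ_eq_sum_range (fun i ↦ C (p.coeff i) * X ^ i)]
  exact (as_sum_range_C_mul_X_pow' p (Nat.lt_succ_of_le h)).symm

/-! ### Degenerating `f` to a power of `x` -/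

section degeneration

variable {k : Type*} [Field k] [CharZero k]

/-- The monic polynomial `f(c x) / c^(d+1)`, where `c` is the leading coefficient of `f` and `d` its
degree. -/
noncomputable def rescaled (k : Type*) [Field k] (f : ℤ[X]) : k[X] :=
  C ((f.leadingCoeff : k) ^ (f.natDegree + 1))⁻¹ *
    (f.map (Int.castRingHom k)).comp (C (f.leadingCoeff : k) * X)

theorem natDegree_map_comp {f : ℤ[X]} (hf : f ≠ 0) :
    ((f.map (Int.castRingHom k)).comp (C (f.leadingCoeff : k) * X)).natDegree = f.natDegree := by
  have hc : (f.leadingCoeff : k) ≠ 0 := Int.cast_ne_zero.2 (leadingCoeff_ne_zero.2 hf)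
  rw [natDegree_comp, natDegree_C_mul_X _ hc, mul_one,
    natDegree_map_eq_of_injective (Int.castRingHom k).injective_int]

theorem natDegree_rescaled {f : ℤ[X]} (hf : f ≠ 0) : (rescaled k f).natDegree = f.natDegree := by
  have hc : (f.leadingCoeff : k) ≠ 0 := Int.cast_ne_zero.2 (leadingCoeff_ne_zero.2 hf)
  rw [rescaled, natDegree_C_mul (inv_ne_zero (pow_ne_zero _ hc)), natDegree_map_comp hf]

theorem monic_rescaled {f : ℤ[X]} (hf : f ≠ 0) : (rescaled k f).Monic := by
  have hc : (f.leadingCoeff : k) ≠ 0 := Int.cast_ne_zero.2 (leadingCoeff_ne_zero.2 hf)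
  rw [Monic, rescaled, leadingCoeff_mul, leadingCoeff_C, leadingCoeff_comp, leadingCoeff_C_mul_X,
    leadingCoeff_map_of_injective (Int.castRingHom k).injective_int,
    natDegree_map_eq_of_injective (Int.castRingHom k).injective_int, eq_intCast, ← pow_succ']
  · exact inv_mul_cancel₀ (pow_ne_zero _ hc)
  · rw [natDegree_C_mul_X _ hc]
    exact one_ne_zero

/-- A one-parameter degeneration over `k[t]` of a member of the family of `f` to a member of the
family of `x^d`. -/
noncomputable def degeneration (f : ℤ[X]) (c : k) (e j : ℕ) : k[X][X] :=
  (X ^ e - C (C c)) ^ 2 - ((rescaled k f).map C).scaleRoots (X ^ 2) * X ^ (2 * j)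

/-- Scaling the roots of a monic polynomial to `0` leaves only its leading power of `x`. -/
theorem degeneration_map_eval_zero {f : ℤ[X]} (hf : f ≠ 0) (c : k) (e j : ℕ) :
    (degeneration f c e j).map (evalRingHom 0) = (X ^ e - C c) ^ 2 - X ^ (f.natDegree + 2 * j) := by
  have hm : ((rescaled k f).map (C : k →+* k[X])).Monic := (monic_rescaled hf).map _
  have h1 : (evalRingHom (0 : k)).comp C = RingHom.id k := by ext; simp
  rw [degeneration, Polynomial.map_sub, Polynomial.map_mul, map_scaleRoots _ _ _ (by simp [hm]),
    Polynomial.map_map, h1, Polynomial.map_id]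
  simp [scaleRoots_zero, monic_rescaled hf, natDegree_rescaled hf, pow_add]

theorem natDegree_degeneration_le {f : ℤ[X]} (hf : f ≠ 0) (c : k) {e j n : ℕ} (h1 : 2 * e ≤ n)
    (h2 : f.natDegree + 2 * j ≤ n) : (degeneration f c e j).natDegree ≤ n := by
  refine (natDegree_sub_le _ _).trans (max_le ?_ ?_)
  · refine natDegree_pow_le.trans ((Nat.mul_le_mul_left 2 ?_).trans h1)
    exact natDegree_sub_C.le.trans (natDegree_X_pow_le _)
  · refine natDegree_mul_le.trans ((add_le_add ?_ (natDegree_X_pow_le _)).trans h2)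
    rw [natDegree_scaleRoots]
    exact natDegree_map_le.trans (natDegree_rescaled hf).le

-- The two terms have different degrees, so their leading terms cannot cancel.
omit [CharZero k] in
theorem natDegree_sq_sub_X_pow (c : k) {e q n : ℕ}
    (h : q = n ∧ 2 * e < n ∨ 2 * e = n ∧ q < n) :
    ((X ^ e - C c) ^ 2 - X ^ q : k[X]).natDegree = n := by
  have h1 : ((X ^ e - C c) ^ 2 : k[X]).natDegree = 2 * e := by
    rw [natDegree_pow, natDegree_X_pow_sub_C]
  rcases h with ⟨rfl, h⟩ | ⟨h, h'⟩
  · rw [natDegree_sub_eq_right_of_natDegree_lt, natDegree_X_pow]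
    rwa [h1, natDegree_X_pow]
  · rw [natDegree_sub_eq_left_of_natDegree_lt, h1, h]
    rwa [h1, natDegree_X_pow, h]

/-- Over `k(t)` the degeneration is, up to scaling `x`, a member of the family of `f`. -/
theorem exists_member_comp_eq {f : ℤ[X]} (hf : f ≠ 0) (hodd : Odd f.natDegree) (c : k)
    (e j : ℕ) : ∃ (α : Fin (e + 1) → RatFunc k) (β : Fin (j + 1) → RatFunc k) (v : RatFunc k),
      v ≠ 0 ∧ (member f α β).comp (C v * X) =
        (degeneration f c e j).map (algebraMap k[X] (RatFunc k)) := by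
  obtain ⟨l, hl⟩ := hodd
  set a : RatFunc k := (f.leadingCoeff : RatFunc k) with ha
  have ha0 : a ≠ 0 := Int.cast_ne_zero.2 (leadingCoeff_ne_zero.2 hf)
  set t : RatFunc k := RatFunc.X with ht
  have ht0 : t ≠ 0 := RatFunc.X_ne_zero
  set γ : RatFunc k := algebraMap k (RatFunc k) c with hγ
  -- The coefficients of `g` and `h` undo the substitution `x ↦ (a/t²) x`; the extra factor in `h`
  -- absorbs the constant relating `f` to its rescaled form.
  let g : (RatFunc k)[X] := C ((t ^ 2 / a) ^ e) * X ^ e - C γ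
  let h : (RatFunc k)[X] := C (t ^ f.natDegree / a ^ (l + 1) * (t ^ 2 / a) ^ j) * X ^ j
  have hg : g.natDegree ≤ e := natDegree_sub_C.le.trans (natDegree_C_mul_X_pow_le _ _)
  have hh : h.natDegree ≤ j := natDegree_C_mul_X_pow_le _ _
  refine ⟨fun i ↦ g.coeff i, fun i ↦ h.coeff i, a / t ^ 2, div_ne_zero ha0 (pow_ne_zero _ ht0), ?_⟩
  rw [member, sum_fin_coeff hg, sum_fin_coeff hh]
  have hginv : t ^ 2 / a * (a / t ^ 2) = 1 := by field_simp
  have e1 : g.comp (C (a / t ^ 2) * X) = X ^ e - C γ := by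
    simp only [g, sub_comp, mul_comp, C_comp, pow_comp, X_comp]
    rw [mul_pow, ← mul_assoc, ← C_pow, ← C_mul, ← mul_pow, hginv, one_pow, C_1, one_mul]
  have e2 : h.comp (C (a / t ^ 2) * X) = C (t ^ f.natDegree / a ^ (l + 1)) * X ^ j := by
    simp only [h, mul_comp, C_comp, pow_comp, X_comp]
    rw [mul_pow, ← mul_assoc, ← C_pow, ← C_mul, mul_assoc, ← mul_pow, hginv, one_pow, mul_one]
  have e3 : ((((rescaled k f).map C).scaleRoots (X ^ 2)).map (algebraMap k[X] (RatFunc k))) =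
      C ((t ^ f.natDegree / a ^ (l + 1)) ^ 2) *
        (f.map (Int.castRingHom (RatFunc k))).comp (C (a / t ^ 2) * X) := by
    have hX : algebraMap k[X] (RatFunc k) (X ^ 2) = t ^ 2 := by
      rw [map_pow, RatFunc.algebraMap_X]
    have key := scaleRoots_eval₂_mul (p := (rescaled k f).map (C : k →+* k[X]))
      ((C : RatFunc k →+* (RatFunc k)[X]).comp (algebraMap k[X] (RatFunc k)))
      (C (1 / t ^ 2) * X) (X ^ 2)
    have hone : (C : RatFunc k →+* (RatFunc k)[X]).comp (algebraMap k[X] (RatFunc k)) (X ^ 2) *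
        (C (1 / t ^ 2) * X) = X := by
      rw [RingHom.comp_apply, hX, ← mul_assoc, ← C_mul, mul_one_div_cancel (pow_ne_zero _ ht0),
        C_1, one_mul]
    rw [hone] at key
    have hmap : ∀ p : k[X][X], eval₂ ((C : RatFunc k →+* (RatFunc k)[X]).comp
        (algebraMap k[X] (RatFunc k))) X p = p.map (algebraMap k[X] (RatFunc k)) := by
      intro p
      rw [← eval₂_map, eval₂_C_X]
    rw [hmap] at key
    rw [key, natDegree_map_eq_of_injective C_injective, natDegree_rescaled hf, RingHom.comp_apply,
      hX, ← eval₂_map, Polynomial.map_map]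
    have hcomp : (f.map (Int.castRingHom k)).map
        ((algebraMap k[X] (RatFunc k)).comp C) = f.map (Int.castRingHom (RatFunc k)) := by
      rw [Polynomial.map_map]
      congr 1
      exact Subsingleton.elim _ _
    have hcast : ((algebraMap k[X] (RatFunc k)).comp C) (f.leadingCoeff : k) = a :=
      map_intCast _ _
    rw [rescaled, Polynomial.map_mul, map_C, Polynomial.map_comp, hcomp, Polynomial.map_mul, map_C,
      map_X, map_inv₀, map_pow, hcast, ← comp, mul_comp, C_comp, comp_assoc, mul_comp, C_comp,
      X_comp, ← mul_assoc (C a), ← C_mul, mul_one_div, ← mul_assoc, map_pow, hcast]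
    -- Odd degree enters here: `f.natDegree + 1 = 2 (l + 1)`, so the constant is a square and can be
    -- moved into `h²`. Scaling by `t²` rather than `t` makes the power of `t` a square too.
    have hconst : (t ^ f.natDegree / a ^ (l + 1)) ^ 2 =
        (t ^ 2) ^ f.natDegree * (a ^ (f.natDegree + 1))⁻¹ := by
      rw [hl]
      field_simp
      ring
    simp only [hconst, C_mul, C_pow]
  rw [sub_comp, mul_comp, pow_comp, pow_comp, e1, e2, degeneration, Polynomial.map_sub,
    Polynomial.map_mul, e3]
  simp only [Polynomial.map_pow, Polynomial.map_sub, map_X, map_C]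
  have : algebraMap k[X] (RatFunc k) (C c) = γ := by
    rw [hγ, RatFunc.algebraMap_C, RatFunc.algebraMap_eq_C]
  rw [this]
  simp only [mul_pow, C_pow]
  ring

theorem card_gal_degenerate_le {f : ℤ[X]} (hf : f ≠ 0) (hodd : Odd f.natDegree) (c : k)
    {e j n : ℕ}
    (h : f.natDegree + 2 * j = n ∧ 2 * e < n ∨ 2 * e = n ∧ f.natDegree + 2 * j < n) :
    Nat.card ((X ^ e - C c) ^ 2 - X ^ (f.natDegree + 2 * j) : k[X]).Gal ≤
      Nat.card (family f e j).Gal := by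
  have h1 : 2 * e ≤ n := by omega
  have h2 : f.natDegree + 2 * j ≤ n := by omega
  have hn : n ≠ 0 := by omega
  obtain ⟨α, β, v, hv, hm⟩ := exists_member_comp_eq hf hodd c e j
  have hF0 := degeneration_map_eval_zero hf c e j
  have hdeg0 : ((degeneration f c e j).map (evalRingHom 0)).natDegree = n := by
    rw [hF0, natDegree_sq_sub_X_pow c h]
  have hdeg := natDegree_degeneration_le hf c h1 h2
  have hdeg1 : n ≤ (member f α β).natDegree := by
    have h3 := congrArg natDegree hm
    rw [natDegree_comp, natDegree_C_mul_X _ hv, mul_one,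
      natDegree_map_eq_of_injective (IsFractionRing.injective k[X] (RatFunc k))] at h3
    rw [h3, ← hdeg0]
    exact natDegree_map_le
  -- Two specializations are chained: the parameters go to `k(t)`, then `t` goes to `0`. A linear
  -- change of variable keeps the splitting field of the member sufficient for the degeneration.
  refine le_trans ?_ (card_gal_member_le f α β h1 h2 hdeg1 hn)
  have := isGalois_splittingField (member f α β)
  rw [← hF0]
  refine card_gal_specialization_le (K := RatFunc k) (L := (member f α β).SplittingField) _ _ ?_ ?_
  · refine map_leadingCoeff_ne_zero _ (hdeg.trans hdeg0.ge) fun h0 ↦ ?_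
    rw [h0, natDegree_zero] at hdeg0
    omega
  · rw [IsScalarTower.algebraMap_eq k[X] (RatFunc k), ← Polynomial.map_map, ← hm,
      Polynomial.map_comp]
    refine (SplittingField.splits _).comp_of_natDegree_le_one ?_
    exact natDegree_map_le.trans (by compute_degree)

end degeneration

theorem factorial_le_card_gal_family {f : ℤ[X]} (hf : f ≠ 0) (hodd : Odd f.natDegree)
    {e j m : ℕ}
    (h : f.natDegree + 2 * j = m + 3 ∧ 2 * e = m + 2 ∨
      2 * e = m + 3 ∧ f.natDegree + 2 * j = m + 2) :
    (m + 3).factorial ≤ Nat.card (family f e j).Gal := by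
  have hX : algebraMap ℚ[X] (RatFunc ℚ) X ≠ 0 := by
    rw [RatFunc.algebraMap_X]
    exact RatFunc.X_ne_zero
  refine (factorial_le_card_gal_trinom (RatFunc ℚ) m).trans
    ((card_gal_trinom_le hX h).trans
      (card_gal_degenerate_le hf hodd _ (n := m + 3) (by omega)))

end HyperellipticFamily

theorem proposition3p1 (f : ℤ[X]) (d n : ℕ)
    (hsq : Squarefree (f.map (Int.castRingHom ℚ)))
    (hd : f.natDegree = d) (hodd : Odd d) (hd3 : 3 ≤ d) (hn : d ≤ n) :
    Irreducible (HyperellipticFamily.family f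
        (HyperellipticFamily.degG n) (HyperellipticFamily.degH d n)) ∧
      Nonempty ((HyperellipticFamily.family f
        (HyperellipticFamily.degG n) (HyperellipticFamily.degH d n)).Gal ≃*
          Equiv.Perm (Fin n)) := by
  subst hd
  have hf : f ≠ 0 := by
    rintro rfl
    simp at hd3
  -- By parity of `n`, one of the two terms of `F_f` has degree bound `n` and the other `n - 1`,
  -- matching the two exponents of the trinomial.
  have key : f.natDegree + 2 * HyperellipticFamily.degH f.natDegree n = n ∧
      2 * HyperellipticFamily.degG n = n - 1 ∨ 2 * HyperellipticFamily.degG n = n ∧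
      f.natDegree + 2 * HyperellipticFamily.degH f.natDegree n = n - 1 := by
    obtain ⟨l, hl⟩ := hodd
    unfold HyperellipticFamily.degG HyperellipticFamily.degH
    split_ifs with h
    · obtain ⟨r, hr⟩ := h
      omega
    · obtain ⟨r, hr⟩ := Nat.not_odd_iff_even.1 h
      omega
  refine HyperellipticFamily.irreducible_and_gal_equiv_perm (by omega) ?_ ?_
  · rw [HyperellipticFamily.family_eq_map]
    exact natDegree_map_le.trans
      (HyperellipticFamily.natDegree_member_le f _ _ (by omega) (by omega))
  · obtain ⟨m, rfl⟩ : ∃ m, n = m + 3 := ⟨n - 3, by omega⟩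
    exact HyperellipticFamily.factorial_le_card_gal_family hf hodd (by omega)
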